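/- Let $A$ be a Hermitian unital Banach $*$-algebra, that is, a complex unital Banach algebra with an involution in which every selfadjoint element has real spectrum. Write $a\ge 0$ if $a^*=a$ and $\sigma(a)\subset[0,\infty)$. Let $\psi:A\to\mathbb{C}$ be a linear functional that is positive ($\psi(a)\ge 0$ whenever $a\ge 0$) and normalized ($\psi(1)=1$). Let $f$ be analytic on an open set $G\subseteq\mathbb{C}$, let $I\subset G$ be a real interval, and suppose that $f$ is real-valued and convex on $I$. Let $m<M$ be real numbers with $[m,M]\subset I$, and let $c\in A$ be selfadjoint with $\sigma(c)\subseteq[m,M]$. Let $f(c)$ be defined by the analytic functional calculus $$f(c)=\frac{1}{2\pi i}\int_\gamma f(z)(z-c)^{-1}\,dz,$$ where $\gamma$ is any closed rectifiable curve in $G\setminus\sigma(c)$ that has index $1$ about every point of $\sigma(c)$ and index $0$ about every point of $\mathbb{C}\setminus G$. Then $\psi(c)\in[m,M]$, $\psi(f(c))$ is real, and $$0\le\psi(f(c))-f(\psi(c))\le\Bigl(1+2\frac{\bigl|\psi(c)-\frac{m+M}{2}\bigr|}{M-m}\Bigr)\Bigl[\frac{f(m)+f(M)}{2}-f\Bigl(\frac{m+M}{2}\Bigr)\Bigr]\le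 f(m)+f(M)-2f\Bigl(\frac{m+M}{2}\Bigr).$$ -/

import Mathlib

open MeasureTheory Set
open scoped NNReal ComplexOrder

noncomputable section

/-- The index (winding number) `(2πi)⁻¹ ∫_γ dz / (z - w)` of a closed rectifiable curve
`γ : [0, 1] → ℂ`, given by a Lipschitz parametrization, about a point `w` off the curve. -/
def curveIndex (γ : ℝ → ℂ) (w : ℂ) : ℂ :=
  (2 * (Real.pi : ℂ) * Complex.I)⁻¹ * ∫ t in (0 : ℝ)..1, deriv γ t / (γ t - w)

/-- `γ` is a closed rectifiable curve in `G` that avoids `K`, has `K` in its inside (index one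
about every point of `K`), and has index zero about every point outside `G`.

Rectifiable curves are represented by Lipschitz parametrizations on `[0, 1]`; every rectifiable
curve has one, namely the one proportional to arc length. -/
structure IsCauchyContour (G K : Set ℂ) (γ : ℝ → ℂ) : Prop where
  lipschitz : ∃ L : ℝ≥0, LipschitzOnWith L γ (Icc 0 1)
  closed : γ 0 = γ 1
  mem_diff : ∀ t ∈ Icc (0 : ℝ) 1, γ t ∈ G \ K
  index_eq_one : ∀ w ∈ K, curveIndex γ w = 1
  index_eq_zero : ∀ w ∉ G, curveIndex γ w = 0

/-- The analytic functional calculus: `f(a) = (2πi)⁻¹ ∫_γ f(z) (z - a)⁻¹ dz`. -/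
def analyticCalculus {A : Type*} [NormedRing A] [NormedAlgebra ℂ A]
    (γ : ℝ → ℂ) (f : ℂ → ℂ) (a : A) : A :=
  (2 * (Real.pi : ℂ) * Complex.I)⁻¹ •
    ∫ t in (0 : ℝ)..1, (f (γ t) * deriv γ t) • Ring.inverse (algebraMap ℂ A (γ t) - a)

/-- Every selfadjoint element has real spectrum. -/
def IsHermitianAlgebra (A : Type*) [Ring A] [Algebra ℂ A] [StarRing A] : Prop :=
  ∀ a : A, IsSelfAdjoint a → ∀ z ∈ spectrum ℂ a, z.im = 0

/-- `a ≥ 0`: the element `a` is selfadjoint and its spectrum is contained in `[0, ∞)`. -/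
def IsNonnegElement {A : Type*} [Ring A] [Algebra ℂ A] [StarRing A] (a : A) : Prop :=
  IsSelfAdjoint a ∧ spectrum ℂ a ⊆ Complex.ofReal '' Ici (0 : ℝ)

/-- `ψ(a) ≥ 0` whenever `a ≥ 0`. The inequality is the one of `ℂ`, that is, `ψ(a)` is a
nonnegative real number. -/
def IsPositiveFunctional {A : Type*} [Ring A] [Algebra ℂ A] [StarRing A]
    (ψ : A →ₗ[ℂ] ℂ) : Prop :=
  ∀ a : A, IsNonnegElement a → 0 ≤ ψ a

end

/-!
The real inequalities follow from two pointwise ones on `[m, M]`: the tangent at `ψ(c)` lies below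
`f`, and the chord over `[m, M]` lies above `f`. A positive functional preserves such inequalities
between `1`, `c` and `f(c)` (`IsPositiveFunctional.nonneg_analyticCalculus`), and the gap between
chord and function is estimated by convexity alone (`ConvexOn.chord_sub_le`).

The transfer to `ψ` takes place in the double commutant of `c`, a commutative closed `*`-subalgebra
in which spectra do not change. By Gelfand theory the spectrum of an element there is the set of
its values under characters, and a character `φ` satisfies `φ(f(c)) = f(φ(c))`, because it is
continuous and Cauchy's integral formula holds on `ℂ`. The contour is an arbitrary Lipschitz curve
of prescribed index, so the homology version of that formula is needed
(`LipschitzOnWith.cauchy_integral_formula`); it is proved by Dixon's method.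

The involution is not assumed continuous, so `f(c)` need not be selfadjoint. Since the algebra is
Hermitian, characters respect the involution; so the imaginary part of an element with real Gelfand
transform is selfadjoint and quasinilpotent, and `ψ`, being positive, vanishes there
(`IsPositiveFunctional.nonneg_of_forall_character`).
-/

open Filter Topology Metric

/-! ### Integration along closed Lipschitz curves -/

theorem LipschitzOnWith.norm_deriv_le_of_mem_Ioo {γ : ℝ → ℂ} {L : ℝ≥0}
    (hγ : LipschitzOnWith L γ (Icc 0 1)) {t : ℝ} (ht : t ∈ Ioo (0 : ℝ) 1) :
    ‖deriv γ t‖ ≤ L :=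
  norm_deriv_le_of_lipschitzOn (Icc_mem_nhds ht.1 ht.2) hγ

theorem ae_mem_Ioo_of_mem_uIoc :
    ∀ᵐ t : ℝ, t ∈ uIoc (0 : ℝ) 1 → t ∈ Ioo (0 : ℝ) 1 := by
  have h : ∀ᵐ t : ℝ, t ≠ 1 := by simp [ae_iff, measure_singleton]
  filter_upwards [h] with t ht h'
  rw [uIoc_of_le zero_le_one] at h'
  exact ⟨h'.1, lt_of_le_of_ne h'.2 ht⟩

theorem uIoc_zero_one_subset_Icc : uIoc (0 : ℝ) 1 ⊆ Icc 0 1 := by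
  rw [uIoc_of_le zero_le_one]
  exact Ioc_subset_Icc_self

theorem LipschitzOnWith.intervalIntegrable_deriv {γ : ℝ → ℂ} {L : ℝ≥0}
    (hγ : LipschitzOnWith L γ (Icc 0 1)) : IntervalIntegrable (deriv γ) volume 0 1 := by
  refine (intervalIntegrable_const (c := (L : ℝ))).mono_fun
    (measurable_deriv γ).aestronglyMeasurable ?_
  rw [EventuallyLE, ae_restrict_iff' measurableSet_uIoc]
  filter_upwards [ae_mem_Ioo_of_mem_uIoc] with t ht h'
  simpa using hγ.norm_deriv_le_of_mem_Ioo (ht h')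

theorem LipschitzOnWith.ae_differentiableAt_uIoc {γ : ℝ → ℂ} {L : ℝ≥0}
    (hγ : LipschitzOnWith L γ (Icc 0 1)) :
    ∀ᵐ t : ℝ, t ∈ uIoc (0 : ℝ) 1 → DifferentiableAt ℝ γ t := by
  filter_upwards [hγ.ae_differentiableWithinAt_of_mem, ae_mem_Ioo_of_mem_uIoc] with t h1 h2 ht
  exact (h1 (Ioo_subset_Icc_self (h2 ht))).differentiableAt (Icc_mem_nhds (h2 ht).1 (h2 ht).2)

/-- The fundamental theorem of calculus for complex-valued Lipschitz functions. -/
theorem LipschitzOnWith.integral_deriv_eq_sub {γ : ℝ → ℂ} {L : ℝ≥0}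
    (hγ : LipschitzOnWith L γ (Icc 0 1)) : ∫ t in (0 : ℝ)..1, deriv γ t = γ 1 - γ 0 := by
  have key : ∀ T : ℂ →L[ℝ] ℝ, T (∫ t in (0 : ℝ)..1, deriv γ t) = T (γ 1 - γ 0) := by
    intro T
    have hT : LipschitzOnWith (‖T‖₊ * L) (fun t => T (γ t)) (uIcc 0 1) := by
      rw [uIcc_of_le zero_le_one]
      exact T.lipschitz.comp_lipschitzOnWith hγ
    rw [map_sub, ← hT.absolutelyContinuousOnInterval.integral_deriv_eq_sub,
      ← T.intervalIntegral_comp_comm hγ.intervalIntegrable_deriv]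
    refine intervalIntegral.integral_congr_ae ?_
    filter_upwards [hγ.ae_differentiableAt_uIoc] with t h1 ht
    exact (T.hasFDerivAt.comp_hasDerivAt t (h1 ht).hasDerivAt).deriv.symm
  exact Complex.ext (key Complex.reCLM) (key Complex.imCLM)

/-- The integral along a closed curve of a function with a holomorphic primitive vanishes. -/
theorem LipschitzOnWith.integral_deriv_comp_mul_deriv_eq_zero {γ : ℝ → ℂ} {L : ℝ≥0}
    (hγ : LipschitzOnWith L γ (Icc 0 1)) (hcl : γ 0 = γ 1) {F F' : ℂ → ℂ} {U : Set ℂ}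
    (hU : IsOpen U) (hF : ∀ z ∈ U, HasDerivAt F (F' z) z) (hγU : ∀ t ∈ Icc (0 : ℝ) 1, γ t ∈ U) :
    ∫ t in (0 : ℝ)..1, F' (γ t) * deriv γ t = 0 := by
  have hFd : DifferentiableOn ℂ F U := fun z hz => (hF z hz).differentiableAt.differentiableWithinAt
  have hloc : LocallyLipschitzOn (γ '' Icc 0 1) F := by
    rintro z ⟨t, ht, rfl⟩
    obtain ⟨K, s, hs, hK⟩ :=
      (hFd.contDiffOn (n := 1) hU).contDiffAt (hU.mem_nhds (hγU t ht)) |>.exists_lipschitzOnWith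
    exact ⟨K, s, mem_nhdsWithin_of_mem_nhds hs, hK⟩
  obtain ⟨K, hK⟩ := hloc.exists_lipschitzOnWith_of_compact
    (isCompact_Icc.image_of_continuousOn hγ.continuousOn)
  have hFγ : LipschitzOnWith (K * L) (F ∘ γ) (Icc 0 1) := hK.comp hγ (mapsTo_image _ _)
  have h := hFγ.integral_deriv_eq_sub
  rw [Function.comp_apply, Function.comp_apply, hcl, sub_self] at h
  rw [← h]
  refine intervalIntegral.integral_congr_ae ?_
  filter_upwards [hγ.ae_differentiableAt_uIoc] with t h1 ht
  exact ((hF _ (hγU t (uIoc_zero_one_subset_Icc ht))).comp t (h1 ht).hasDerivAt).deriv.symm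

/-- Differentiation under the integral sign for a bounded family of holomorphic functions; the
bound on the derivatives comes from Cauchy's estimate. -/
theorem hasDerivAt_integral_of_bounded_holomorphic {k : ℂ → ℝ → ℂ} {w₀ : ℂ} {r C : ℝ} (hr : 0 < r)
    (hmeas : ∀ w ∈ ball w₀ r, AEStronglyMeasurable (k w) (volume.restrict (uIoc 0 1)))
    (hbound : ∀ᵐ t : ℝ, t ∈ uIoc (0 : ℝ) 1 → ∀ w ∈ ball w₀ r, ‖k w t‖ ≤ C)
    (hdiff : ∀ᵐ t : ℝ, t ∈ uIoc (0 : ℝ) 1 → DifferentiableOn ℂ (fun w => k w t) (ball w₀ r)) :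
    HasDerivAt (fun w => ∫ t in (0 : ℝ)..1, k w t)
      (∫ t in (0 : ℝ)..1, deriv (fun w => k w t) w₀) w₀ := by
  have hw₀ : w₀ ∈ ball w₀ r := mem_ball_self hr
  have hd : ∀ᵐ t : ℝ, t ∈ uIoc (0 : ℝ) 1 → ∀ w ∈ ball w₀ r,
      HasDerivAt (fun w => k w t) (deriv (fun w => k w t) w) w := by
    filter_upwards [hdiff] with t h ht w hw
    exact ((h ht).differentiableAt (isOpen_ball.mem_nhds hw)).hasDerivAt
  refine (intervalIntegral.hasDerivAt_integral_of_dominated_loc_of_deriv_le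
    (F' := fun w t => deriv (fun w => k w t) w) (bound := fun _ => C / (r / 4))
    (ball_mem_nhds w₀ (half_pos hr)) ?_ ?_ ?_ ?_ ?_ ?_).2
  · filter_upwards [ball_mem_nhds w₀ hr] with w hw using hmeas w hw
  · refine (intervalIntegrable_const (c := C)).mono_fun (hmeas w₀ hw₀) ?_
    rw [EventuallyLE, ae_restrict_iff' measurableSet_uIoc]
    filter_upwards [hbound] with t h ht
    exact (h ht w₀ hw₀).trans (le_abs_self C)
  · -- the derivative at `w₀` is a limit of difference quotients along a sequence
    let u : ℕ → ℂ := fun n => ((r / 2 / (n + 1) : ℝ) : ℂ)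
    have hpos : ∀ n : ℕ, 0 < r / 2 / ((n : ℝ) + 1) := fun n => by positivity
    have hu0 : Tendsto u atTop (𝓝[≠] 0) := by
      refine tendsto_nhdsWithin_iff.2 ⟨?_, Eventually.of_forall fun n => ?_⟩
      · have h := (tendsto_one_div_add_atTop_nhds_zero_nat (𝕜 := ℝ)).const_mul (r / 2)
        simp only [mul_one_div, mul_zero] at h
        have h' : Tendsto u atTop (𝓝 ((0 : ℝ) : ℂ)) := (Complex.continuous_ofReal.tendsto 0).comp h
        rwa [Complex.ofReal_zero] at h'
      · exact Complex.ofReal_ne_zero.2 (hpos n).ne'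
    have humem : ∀ n, w₀ + u n ∈ ball w₀ r := fun n => by
      rw [mem_ball, dist_self_add_left, Complex.norm_real, Real.norm_of_nonneg (hpos n).le]
      have : r / 2 / ((n : ℝ) + 1) ≤ r / 2 :=
        div_le_self (by positivity) (by linarith [n.cast_nonneg (α := ℝ)])
      linarith
    refine aestronglyMeasurable_of_tendsto_ae atTop
      (f := fun n t => (u n)⁻¹ • (k (w₀ + u n) t - k w₀ t))
      (fun n => ((hmeas _ (humem n)).sub (hmeas _ hw₀)).const_smul (u n)⁻¹) ?_
    rw [ae_restrict_iff' measurableSet_uIoc]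
    filter_upwards [hd] with t h ht
    exact (hasDerivAt_iff_tendsto_slope_zero.1 (h ht w₀ hw₀)).comp hu0
  · filter_upwards [hdiff, hbound] with t h1 h2 ht w hw
    have hsub : closedBall w (r / 4) ⊆ ball w₀ r := fun z hz => by
      rw [mem_ball] at hw ⊢
      rw [mem_closedBall] at hz
      linarith [dist_triangle z w w₀]
    refine Complex.norm_deriv_le_of_forall_mem_sphere_norm_le (by positivity) ?_
      fun z hz => h2 ht z (hsub (sphere_subset_closedBall hz))
    exact ((h1 ht).mono hsub).diffContOnCl_ball subset_rfl
  · exact intervalIntegrable_const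
  · filter_upwards [hd] with t h ht w hw
    exact h ht w (ball_subset_ball (half_le_self hr.le) hw)

/-! ### Cauchy's integral formula for Lipschitz cycles -/

section CauchyFormula

variable {γ : ℝ → ℂ} {L : ℝ≥0}

/-- A Cauchy-type integral is holomorphic off the curve. -/
theorem LipschitzOnWith.hasDerivAt_cauchyIntegral (hγ : LipschitzOnWith L γ (Icc 0 1))
    {g : ℝ → ℂ} (hg : ContinuousOn g (Icc 0 1)) {w₀ : ℂ} (hw₀ : w₀ ∉ γ '' Icc 0 1) :
    HasDerivAt (fun w => ∫ t in (0 : ℝ)..1, g t * deriv γ t / (γ t - w))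
      (∫ t in (0 : ℝ)..1, g t * deriv γ t / (γ t - w₀) ^ 2) w₀ := by
  have hK : IsCompact (γ '' Icc 0 1) := isCompact_Icc.image_of_continuousOn hγ.continuousOn
  obtain ⟨r, hr, hrK⟩ := isOpen_iff.1 hK.isClosed.isOpen_compl w₀ hw₀
  obtain ⟨B, hB⟩ := isCompact_Icc.exists_bound_of_continuousOn hg
  have hB0 : 0 ≤ B := (norm_nonneg _).trans (hB 0 (by simp))
  have hfar : ∀ t ∈ Icc (0 : ℝ) 1, ∀ w ∈ ball w₀ (r / 2), r / 2 ≤ ‖γ t - w‖ := by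
    intro t ht w hw
    have h1 : r ≤ dist (γ t) w₀ := by
      by_contra h
      exact hrK (mem_ball.2 (not_le.1 h)) ⟨t, ht, rfl⟩
    rw [mem_ball] at hw
    rw [← dist_eq_norm]
    linarith [dist_triangle (γ t) w w₀]
  have hne : ∀ t ∈ Icc (0 : ℝ) 1, ∀ w ∈ ball w₀ (r / 2), γ t - w ≠ 0 := fun t ht w hw =>
    norm_pos_iff.1 ((half_pos hr).trans_le (hfar t ht w hw))
  have hk : ∀ t ∈ Icc (0 : ℝ) 1, ∀ w ∈ ball w₀ (r / 2),
      HasDerivAt (fun w => g t * deriv γ t / (γ t - w)) (g t * deriv γ t / (γ t - w) ^ 2) w := by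
    intro t ht w hw
    have h := ((hasDerivAt_id w).const_sub (γ t)).inv (hne t ht w hw)
    simpa [div_eq_mul_inv] using h.const_mul (g t * deriv γ t)
  have h := hasDerivAt_integral_of_bounded_holomorphic (k := fun w t => g t * deriv γ t / (γ t - w))
    (w₀ := w₀) (C := B * L / (r / 2)) (half_pos hr) (fun w hw => ?_) ?_ ?_
  · convert! h using 1
    refine intervalIntegral.integral_congr fun t ht => ?_
    rw [uIcc_of_le zero_le_one] at ht
    exact (hk t ht w₀ (mem_ball_self (half_pos hr))).deriv.symm
  · have hc : ContinuousOn (fun t => g t / (γ t - w)) (Icc 0 1) :=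
      hg.div (hγ.continuousOn.sub continuousOn_const) fun t ht => hne t ht w hw
    have := (hγ.intervalIntegrable_deriv.continuousOn_mul
      (by rwa [uIcc_of_le zero_le_one])).def'.aestronglyMeasurable
    simpa only [div_mul_eq_mul_div] using this
  · filter_upwards [ae_mem_Ioo_of_mem_uIoc] with t h1 ht w hw
    have ht' := uIoc_zero_one_subset_Icc ht
    rw [norm_div, norm_mul]
    exact div_le_div₀ (by positivity)
      (mul_le_mul (hB t ht') (hγ.norm_deriv_le_of_mem_Ioo (h1 ht)) (norm_nonneg _) hB0)
      (half_pos hr) (hfar t ht' w hw)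
  · exact Eventually.of_forall fun t ht w hw =>
      (hk t (uIoc_zero_one_subset_Icc ht) w hw).differentiableAt.differentiableWithinAt

/-- The integral defining the index is locally constant off the curve. -/
theorem LipschitzOnWith.eventually_index_eq (hγ : LipschitzOnWith L γ (Icc 0 1))
    (hcl : γ 0 = γ 1) {w₀ : ℂ} (hw₀ : w₀ ∉ γ '' Icc 0 1) :
    ∀ᶠ w in 𝓝 w₀, ∫ t in (0 : ℝ)..1, deriv γ t / (γ t - w) =
      ∫ t in (0 : ℝ)..1, deriv γ t / (γ t - w₀) := by
  have hK : IsCompact (γ '' Icc 0 1) := isCompact_Icc.image_of_continuousOn hγ.continuousOn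
  obtain ⟨r, hr, hrK⟩ := isOpen_iff.1 hK.isClosed.isOpen_compl w₀ hw₀
  have hder : ∀ w ∈ ball w₀ r,
      HasDerivAt (fun w => ∫ t in (0 : ℝ)..1, deriv γ t / (γ t - w)) 0 w := by
    intro w hw
    have h := hγ.hasDerivAt_cauchyIntegral (g := fun _ => 1) continuousOn_const (hrK hw)
    simp only [one_mul] at h
    have h0 : ∫ t in (0 : ℝ)..1, deriv γ t / (γ t - w) ^ 2 = 0 := by
      have := hγ.integral_deriv_comp_mul_deriv_eq_zero hcl (U := {w}ᶜ)
        (F := fun z => -(z - w)⁻¹) (F' := fun z => ((z - w) ^ 2)⁻¹) isOpen_compl_singleton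
        (fun z hz => by
          convert! (((hasDerivAt_id z).sub_const w).inv (sub_ne_zero.2 hz)).neg using 1
          simp [neg_div])
        (fun t ht h => hrK hw ⟨t, ht, h⟩)
      simpa only [div_eq_inv_mul] using this
    rwa [h0] at h
  filter_upwards [ball_mem_nhds w₀ hr] with w hw
  exact (convex_ball w₀ r).is_const_of_fderivWithin_eq_zero (𝕜 := ℂ)
    (fun z hz => (hder z hz).differentiableAt.differentiableWithinAt)
    (fun z hz => by
      rw [fderivWithin_of_isOpen isOpen_ball hz]
      ext
      simpa using (hder z hz).deriv) hw (mem_ball_self hr)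

/-- A closed curve has index zero about every point outside a disc that contains it: the function
`z ↦ log (1 - z / w)` is a primitive of the integrand on that disc. -/
theorem LipschitzOnWith.index_eq_zero_of_lt_norm (hγ : LipschitzOnWith L γ (Icc 0 1))
    (hcl : γ 0 = γ 1) {R : ℝ} (hR : ∀ t ∈ Icc (0 : ℝ) 1, ‖γ t‖ ≤ R) {w : ℂ} (hw : R < ‖w‖) :
    ∫ t in (0 : ℝ)..1, deriv γ t / (γ t - w) = 0 := by
  have hw0 : w ≠ 0 := norm_pos_iff.1 (((norm_nonneg _).trans (hR 0 (by simp))).trans_lt hw)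
  have := hγ.integral_deriv_comp_mul_deriv_eq_zero hcl (U := ball 0 ‖w‖)
    (F := fun z => Complex.log (1 - z / w)) (F' := fun z => (z - w)⁻¹) isOpen_ball
    (fun z hz => by
      have hz' : ‖z‖ < ‖w‖ := by simpa using hz
      have hs : 1 - z / w ∈ Complex.slitPlane := by
        refine Complex.mem_slitPlane_of_norm_lt_one (z := -(z / w)) ?_
        rw [norm_neg, norm_div]
        exact (div_lt_one (norm_pos_iff.2 hw0)).2 hz'
      have hzw : z - w ≠ 0 := sub_ne_zero.2 fun h => hz'.ne (by rw [h])
      have hwz : w - z ≠ 0 := sub_ne_zero.2 fun h => hz'.ne (by rw [h])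
      convert! (((hasDerivAt_id z).div_const w).const_sub 1).clog hs using 1
      have : (1 : ℂ) - z / w = (w - z) / w := by field_simp
      simp only [id]
      rw [this, ← neg_sub w z]
      field_simp)
    (fun t ht => by simpa using (hR t ht).trans_lt hw)
  simpa only [div_eq_inv_mul] using this

theorem dslope_swap {f : ℂ → ℂ} (a b : ℂ) : dslope f a b = dslope f b a := by
  rcases eq_or_ne a b with rfl | h
  · rfl
  · rw [dslope_of_ne _ h.symm, dslope_of_ne _ h, slope_comm]

/-- The difference quotients of a holomorphic function are locally bounded in one variable,
uniformly in the other one over a set on which the function is bounded. Near the diagonal this is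
the maximum modulus principle. -/
theorem exists_bound_dslope {f : ℂ → ℂ} {w₀ : ℂ} {r B : ℝ} (hr : 0 < r)
    (hf : DifferentiableOn ℂ f (closedBall w₀ (4 * r)))
    (hB : ∀ w ∈ closedBall w₀ (4 * r), ‖f w‖ ≤ B) {z w : ℂ} (hz : ‖f z‖ ≤ B)
    (hw : w ∈ ball w₀ r) : ‖dslope f z w‖ ≤ 2 * B / r := by
  have hoff : ∀ w ∈ closedBall w₀ (4 * r), r ≤ ‖w - z‖ → ‖dslope f z w‖ ≤ 2 * B / r := by
    intro w hw hwz
    have hne : w ≠ z := fun h => by simp [h] at hwz; linarith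
    rw [dslope_of_ne _ hne, slope_def_field, norm_div]
    exact div_le_div₀ (by linarith [(norm_nonneg _).trans hz])
      ((norm_sub_le _ _).trans (by linarith [hB w hw])) hr hwz
  have hsub : ball w₀ r ⊆ closedBall w₀ (4 * r) :=
    ball_subset_closedBall.trans (closedBall_subset_closedBall (by linarith))
  rcases le_or_gt (2 * r) (dist z w₀) with h | h
  · refine hoff w (hsub hw) ?_
    rw [mem_ball] at hw
    rw [← dist_eq_norm, dist_comm]
    linarith [dist_triangle z w w₀]
  · have hzb : closedBall w₀ (4 * r) ∈ 𝓝 z :=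
      mem_of_superset (isOpen_ball.mem_nhds (mem_ball.2 h))
        (ball_subset_closedBall.trans (closedBall_subset_closedBall (by linarith)))
    have hd : DifferentiableOn ℂ (dslope f z) (closedBall w₀ (4 * r)) :=
      (Complex.differentiableOn_dslope hzb).2 hf
    refine Complex.norm_le_of_forall_mem_frontier_norm_le (U := ball w₀ (4 * r))
      isBounded_ball (hd.diffContOnCl_ball subset_rfl) (fun v hv => ?_)
      (subset_closure (ball_subset_ball (by linarith) hw))
    rw [frontier_ball _ (by positivity), mem_sphere] at hv
    refine hoff v (mem_closedBall.2 hv.le) ?_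
    rw [← dist_eq_norm]
    linarith [dist_triangle v z w₀]

/-- The function `w ↦ ∫_γ (f z - f w) / (z - w) dz` of Dixon's proof is holomorphic. -/
theorem LipschitzOnWith.differentiableAt_integral_dslope (hγ : LipschitzOnWith L γ (Icc 0 1))
    {G : Set ℂ} (hG : IsOpen G) {f : ℂ → ℂ} (hf : DifferentiableOn ℂ f G)
    (hγG : ∀ t ∈ Icc (0 : ℝ) 1, γ t ∈ G) {w₀ : ℂ} (hw₀ : w₀ ∈ G) :
    DifferentiableAt ℂ (fun w => ∫ t in (0 : ℝ)..1, dslope f w (γ t) * deriv γ t) w₀ := by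
  obtain ⟨ρ, hρ, hρG⟩ := nhds_basis_closedBall.mem_iff.1 (hG.mem_nhds hw₀)
  obtain ⟨r, hr, rfl⟩ : ∃ r : ℝ, 0 < r ∧ ρ = 4 * r := ⟨ρ / 4, by positivity, by ring⟩
  obtain ⟨B₁, hB₁⟩ := isCompact_Icc.exists_bound_of_continuousOn
    (hf.continuousOn.comp hγ.continuousOn hγG)
  obtain ⟨B₂, hB₂⟩ := (isCompact_closedBall w₀ (4 * r)).exists_bound_of_continuousOn
    (hf.continuousOn.mono hρG)
  have hball : ball w₀ r ⊆ G :=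
    (ball_subset_closedBall.trans (closedBall_subset_closedBall (by linarith))).trans hρG
  have hbd : ∀ t ∈ Icc (0 : ℝ) 1, ∀ w ∈ ball w₀ r,
      ‖dslope f w (γ t)‖ ≤ 2 * max B₁ B₂ / r := fun t ht w hw => by
    rw [dslope_swap]
    exact exists_bound_dslope hr (hf.mono hρG)
      (fun v hv => (hB₂ v hv).trans (le_max_right _ _)) ((hB₁ t ht).trans (le_max_left _ _)) hw
  refine (hasDerivAt_integral_of_bounded_holomorphic
    (k := fun w t => dslope f w (γ t) * deriv γ t) (C := 2 * max B₁ B₂ / r * L) hr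
    (fun w hw => ?_) ?_ ?_).differentiableAt
  · have hc : ContinuousOn (fun t => dslope f w (γ t)) (Icc 0 1) :=
      (((Complex.differentiableOn_dslope (hG.mem_nhds (hball hw))).2 hf).continuousOn).comp
        hγ.continuousOn hγG
    exact (hγ.intervalIntegrable_deriv.continuousOn_mul
      (by rwa [uIcc_of_le zero_le_one])).def'.aestronglyMeasurable
  · filter_upwards [ae_mem_Ioo_of_mem_uIoc] with t h1 ht w hw
    have hb := hbd t (uIoc_zero_one_subset_Icc ht) w hw
    rw [norm_mul]
    exact mul_le_mul hb (hγ.norm_deriv_le_of_mem_Ioo (h1 ht)) (norm_nonneg _)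
      ((norm_nonneg _).trans hb)
  · refine Eventually.of_forall fun t ht => ?_
    have hd := (Complex.differentiableOn_dslope
      (hG.mem_nhds (hγG t (uIoc_zero_one_subset_Icc ht)))).2 hf
    simp only [fun w => dslope_swap (f := f) w (γ t)]
    exact (hd.mono hball).mul_const _

/-- **Cauchy's integral formula**, homology version (Dixon's proof): the functions
`w ↦ ∫_γ (f z - f w) / (z - w) dz` on `G` and `w ↦ ∫_γ f z / (z - w) dz` on the set where the index
vanishes agree where both are defined, and form an entire function that tends to zero at
infinity. -/
theorem LipschitzOnWith.cauchy_integral_formula (hγ : LipschitzOnWith L γ (Icc 0 1))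
    (hcl : γ 0 = γ 1) {G : Set ℂ} (hG : IsOpen G) {f : ℂ → ℂ} (hf : DifferentiableOn ℂ f G)
    (hγG : ∀ t ∈ Icc (0 : ℝ) 1, γ t ∈ G)
    (hind : ∀ w ∉ G, ∫ t in (0 : ℝ)..1, deriv γ t / (γ t - w) = 0)
    {w : ℂ} (hwG : w ∈ G) (hw : w ∉ γ '' Icc 0 1) :
    ∫ t in (0 : ℝ)..1, f (γ t) * deriv γ t / (γ t - w) =
      f w * ∫ t in (0 : ℝ)..1, deriv γ t / (γ t - w) := by
  classical
  have hfγ : ContinuousOn (fun t => f (γ t)) (Icc 0 1) :=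
    hf.continuousOn.comp hγ.continuousOn hγG
  set h₁ : ℂ → ℂ := fun w => ∫ t in (0 : ℝ)..1, dslope f w (γ t) * deriv γ t with hh₁
  set h₂ : ℂ → ℂ := fun w => ∫ t in (0 : ℝ)..1, f (γ t) * deriv γ t / (γ t - w) with hh₂
  have hsplit : ∀ w ∉ γ '' Icc 0 1,
      h₁ w = h₂ w - f w * ∫ t in (0 : ℝ)..1, deriv γ t / (γ t - w) := by
    intro w hw
    have hne : ∀ t ∈ Icc (0 : ℝ) 1, γ t - w ≠ 0 := fun t ht h =>
      hw ⟨t, ht, sub_eq_zero.1 h⟩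
    have hint : ∀ g : ℝ → ℂ, ContinuousOn g (Icc 0 1) →
        IntervalIntegrable (fun t => g t * deriv γ t / (γ t - w)) volume 0 1 := by
      intro g hg
      have hc : ContinuousOn (fun t => g t / (γ t - w)) (Icc 0 1) :=
        hg.div (hγ.continuousOn.sub continuousOn_const) hne
      have := hγ.intervalIntegrable_deriv.continuousOn_mul
        (g := fun t => g t / (γ t - w)) (by rwa [uIcc_of_le zero_le_one])
      simpa only [div_mul_eq_mul_div] using this
    rw [hh₁, hh₂, ← intervalIntegral.integral_const_mul]
    simp only [← mul_div_assoc]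
    rw [← intervalIntegral.integral_sub (hint _ hfγ) (hint (fun _ => f w) continuousOn_const)]
    refine intervalIntegral.integral_congr fun t ht => ?_
    rw [uIcc_of_le zero_le_one] at ht
    rw [dslope_of_ne _ (sub_ne_zero.1 (hne t ht)), slope_def_field]
    ring
  -- the entire function glued from `h₁` on `G` and `h₂` on the set where the index vanishes
  set H : ℂ → ℂ := fun w => if w ∈ G then h₁ w else h₂ w with hH
  have hH₂ : ∀ w ∉ γ '' Icc 0 1, ∫ t in (0 : ℝ)..1, deriv γ t / (γ t - w) = 0 → H w = h₂ w := by
    intro w hw h0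
    simp only [hH]
    split_ifs with h
    · rw [hsplit w hw, h0, mul_zero, sub_zero]
    · rfl
  have hK : IsCompact (γ '' Icc 0 1) := isCompact_Icc.image_of_continuousOn hγ.continuousOn
  have hHd : Differentiable ℂ H := by
    intro w₀
    by_cases hw₀ : w₀ ∈ G
    · refine (hγ.differentiableAt_integral_dslope hG hf hγG hw₀).congr_of_eventuallyEq ?_
      filter_upwards [hG.mem_nhds hw₀] with w hw
      exact if_pos hw
    · have hw₀γ : w₀ ∉ γ '' Icc 0 1 := by
        rintro ⟨t, ht, rfl⟩
        exact hw₀ (hγG t ht)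
      refine (hγ.hasDerivAt_cauchyIntegral hfγ hw₀γ).differentiableAt.congr_of_eventuallyEq ?_
      filter_upwards [hγ.eventually_index_eq hcl hw₀γ,
        hK.isClosed.isOpen_compl.mem_nhds hw₀γ] with w h1 h2
      exact hH₂ w h2 (h1.trans (hind w₀ hw₀))
  obtain ⟨R, hR⟩ := isCompact_Icc.exists_bound_of_continuousOn hγ.continuousOn
  obtain ⟨B, hB⟩ := isCompact_Icc.exists_bound_of_continuousOn hfγ
  have hlim : Tendsto H (cocompact ℂ) (𝓝 0) := by
    have hlim' : Tendsto (fun w : ℂ => B * L / (‖w‖ - R)) (cocompact ℂ) (𝓝 0) :=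
      Tendsto.div_atTop tendsto_const_nhds
        (tendsto_atTop_add_const_right _ (-R) (tendsto_norm_cocompact_atTop (E := ℂ)))
    refine squeeze_zero_norm' ?_ hlim'
    filter_upwards [(tendsto_norm_cocompact_atTop (E := ℂ)).eventually_gt_atTop R] with w hw
    have hwγ : w ∉ γ '' Icc 0 1 := by
      rintro ⟨t, ht, rfl⟩
      exact hw.not_ge (hR t ht)
    rw [hH₂ w hwγ (hγ.index_eq_zero_of_lt_norm hcl hR hw)]
    have hbd := intervalIntegral.norm_integral_le_of_norm_le_const_ae (a := 0) (b := 1)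
      (C := B * L / (‖w‖ - R)) (f := fun t => f (γ t) * deriv γ t / (γ t - w)) ?_
    · simpa using hbd
    · filter_upwards [ae_mem_Ioo_of_mem_uIoc] with t h1 ht
      have ht' := uIoc_zero_one_subset_Icc ht
      have hBt := hB t ht'
      have hd : ‖w‖ - R ≤ ‖γ t - w‖ := by
        rw [norm_sub_rev]
        linarith [norm_sub_norm_le w (γ t), hR t ht']
      rw [norm_div, norm_mul]
      exact div_le_div₀ (mul_nonneg ((norm_nonneg _).trans hBt) L.2)
        (mul_le_mul hBt (hγ.norm_deriv_le_of_mem_Ioo (h1 ht)) (norm_nonneg _)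
          ((norm_nonneg _).trans hBt)) (sub_pos.2 hw) hd
  have hzero : H w = 0 := hHd.apply_eq_of_tendsto_cocompact w hlim
  rw [hH] at hzero
  simp only [if_pos hwG] at hzero
  rw [hsplit w hw, sub_eq_zero] at hzero
  exact hzero

end CauchyFormula

/-! ### Commutative Hermitian Banach algebras -/

section Commutative

open WeakDual

variable {B : Type*} [NormedCommRing B] [NormedAlgebra ℂ B] [CompleteSpace B]

theorem isNonnegElement_of_forall_character [StarRing B] {a : B} (ha : IsSelfAdjoint a)
    (h : ∀ φ : characterSpace ℂ B, 0 ≤ φ a) : IsNonnegElement a := by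
  refine ⟨ha, fun z hz => ?_⟩
  obtain ⟨φ, rfl⟩ := CharacterSpace.mem_spectrum_iff_exists.1 hz
  obtain ⟨hre, him⟩ := Complex.nonneg_iff.1 (h φ)
  exact ⟨(φ a).re, hre, Complex.ext rfl him⟩

/-- Characters of a Hermitian commutative Banach algebra are `*`-homomorphisms. -/
theorem IsHermitianAlgebra.character_star [StarRing B] [StarModule ℂ B]
    (hB : IsHermitianAlgebra B) (φ : characterSpace ℂ B) (a : B) :
    φ (star a) = star (φ a) := by
  have h1 := hB (a + star a) (IsSelfAdjoint.add_star_self a) _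
    (CharacterSpace.mem_spectrum_iff_exists.2 ⟨φ, rfl⟩)
  have h2 := hB (Complex.I • (star a - a)) (by simp [isSelfAdjoint_iff, ← smul_neg]) _
    (CharacterSpace.mem_spectrum_iff_exists.2 ⟨φ, rfl⟩)
  simp only [map_add, map_smul, map_sub, smul_eq_mul, Complex.add_im, Complex.mul_im,
    Complex.I_re, Complex.I_im, Complex.sub_re, Complex.sub_im] at h1 h2
  apply Complex.ext <;> simp <;> linarith

/-- A positive functional on a Hermitian commutative Banach algebra is nonnegative at every element
whose Gelfand transform is nonnegative. Such an element need not be selfadjoint, because the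
involution is not assumed continuous; but its imaginary part is a selfadjoint quasinilpotent `v`,
and a positive functional vanishes at `v` because both `v` and `-v` are nonnegative. -/
theorem IsPositiveFunctional.nonneg_of_forall_character [StarRing B] [StarModule ℂ B]
    (hB : IsHermitianAlgebra B) {ψ : B →ₗ[ℂ] ℂ} (hψ : IsPositiveFunctional ψ) {a : B}
    (h : ∀ φ : characterSpace ℂ B, 0 ≤ φ a) : 0 ≤ ψ a := by
  have hstar : ∀ φ : characterSpace ℂ B, φ (star a) = φ a := fun φ => by
    rw [hB.character_star]
    exact (IsSelfAdjoint.of_nonneg (h φ)).star_eq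
  set u : B := a + star a with hu
  set v : B := Complex.I • (star a - a) with hv
  have hvsa : IsSelfAdjoint v := by simp [hv, isSelfAdjoint_iff, ← smul_neg]
  have hφv : ∀ φ : characterSpace ℂ B, φ v = 0 := fun φ => by
    rw [hv, map_smul, map_sub, hstar, sub_self, smul_zero]
  have h1 : 0 ≤ ψ u := hψ u <| isNonnegElement_of_forall_character
    (IsSelfAdjoint.add_star_self a) fun φ => by
      rw [hu, map_add, hstar]
      exact add_nonneg (h φ) (h φ)
  have h2 : 0 ≤ ψ v := hψ v <| isNonnegElement_of_forall_character hvsa fun φ => (hφv φ).ge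
  have h3 : 0 ≤ ψ (-v) := hψ (-v) <| isNonnegElement_of_forall_character hvsa.neg fun φ => by
    rw [map_neg, hφv, neg_zero]
  rw [map_neg, neg_nonneg] at h3
  have h4 : ψ v = 0 := le_antisymm h3 h2
  have h5 : (2 : ℂ) • a = u + Complex.I • v := by
    rw [hv, smul_smul, Complex.I_mul_I, two_smul]
    simp [hu]
  have h6 : 2 * ψ a = ψ u := by
    have := congrArg ψ h5
    simpa [h4] using this
  rw [← h6] at h1
  have h7 : ψ a = 2⁻¹ * (2 * ψ a) := by ring
  rw [h7]
  exact mul_nonneg (inv_nonneg.2 zero_le_two) h1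

end Commutative

/-! ### The analytic functional calculus -/

section Calculus

theorem intervalIntegrable_analyticCalculus {A : Type*} [NormedRing A] [NormedAlgebra ℂ A]
    [CompleteSpace A] {G : Set ℂ} {f : ℂ → ℂ} (hf : ContinuousOn f G) {a : A} {γ : ℝ → ℂ}
    (hγ : IsCauchyContour G (spectrum ℂ a) γ) :
    IntervalIntegrable
      (fun t => (f (γ t) * deriv γ t) • Ring.inverse (algebraMap ℂ A (γ t) - a)) volume 0 1 := by
  obtain ⟨L, hL⟩ := hγ.lipschitz
  have hfγ : ContinuousOn (fun t => f (γ t)) (uIcc 0 1) := by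
    rw [uIcc_of_le zero_le_one]
    exact hf.comp hL.continuousOn fun t ht => (hγ.mem_diff t ht).1
  refine (hL.intervalIntegrable_deriv.continuousOn_mul hfγ).smul_continuousOn ?_
  rw [uIcc_of_le zero_le_one]
  intro t ht
  have hu : IsUnit (algebraMap ℂ A (γ t) - a) := spectrum.notMem_iff.1 (hγ.mem_diff t ht).2
  have hc : ContinuousWithinAt (fun t => algebraMap ℂ A (γ t) - a) (Icc 0 1) t :=
    (((algebraMapCLM ℂ A).continuous.comp_continuousOn hL.continuousOn).sub
      continuousOn_const) t ht
  obtain ⟨x, hx⟩ := hu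
  have hi : ContinuousAt Ring.inverse (algebraMap ℂ A (γ t) - a) :=
    hx ▸ NormedRing.inverse_continuousAt x
  exact ContinuousAt.comp_continuousWithinAt (f := fun t => algebraMap ℂ A (γ t) - a) hi hc

theorem Ring.inverse_map_of_isUnit {R S F : Type*} [MonoidWithZero R] [MonoidWithZero S]
    [FunLike F R S] [MonoidHomClass F R S] (φ : F) {a : R} (ha : IsUnit a) :
    φ (Ring.inverse a) = Ring.inverse (φ a) := by
  obtain ⟨x, rfl⟩ := ha
  rw [Ring.inverse_unit]
  exact (Ring.inverse_unit (Units.map (φ : R →* S) x)).symm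

/-- Continuous homomorphisms commute with the analytic functional calculus. -/
theorem map_analyticCalculus {A B : Type*} [NormedRing A] [NormedAlgebra ℂ A]
    [CompleteSpace A] [NormedRing B] [NormedAlgebra ℂ B] [CompleteSpace B] (φ : A →ₐ[ℂ] B)
    (hφ : Continuous φ) {G : Set ℂ} {f : ℂ → ℂ} (hf : ContinuousOn f G) {a : A} {γ : ℝ → ℂ}
    (hγ : IsCauchyContour G (spectrum ℂ a) γ) :
    φ (analyticCalculus γ f a) = analyticCalculus γ f (φ a) := by
  let Φ : A →L[ℂ] B := ⟨φ.toLinearMap, hφ⟩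
  have h : ∫ t in (0 : ℝ)..1,
        φ ((f (γ t) * deriv γ t) • Ring.inverse (algebraMap ℂ A (γ t) - a)) =
      φ (∫ t in (0 : ℝ)..1, (f (γ t) * deriv γ t) • Ring.inverse (algebraMap ℂ A (γ t) - a)) :=
    Φ.intervalIntegral_comp_comm (intervalIntegrable_analyticCalculus hf hγ)
  unfold analyticCalculus
  rw [map_smul, ← h]
  congr 1
  refine intervalIntegral.integral_congr fun t ht => ?_
  rw [uIcc_of_le zero_le_one] at ht
  rw [map_smul, Ring.inverse_map_of_isUnit φ (spectrum.notMem_iff.1 (hγ.mem_diff t ht).2), map_sub,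
    AlgHom.commutes]

/-- On scalars the analytic functional calculus is evaluation. -/
theorem analyticCalculus_complex {G : Set ℂ} (hG : IsOpen G) {f : ℂ → ℂ}
    (hf : DifferentiableOn ℂ f G) {K : Set ℂ} {γ : ℝ → ℂ} (hγ : IsCauchyContour G K γ) {w : ℂ}
    (hwK : w ∈ K) (hwG : w ∈ G) : analyticCalculus γ f w = f w := by
  obtain ⟨L, hL⟩ := hγ.lipschitz
  have hpi : (2 * (Real.pi : ℂ) * Complex.I)⁻¹ ≠ 0 := inv_ne_zero Complex.two_pi_I_ne_zero
  have h := hL.cauchy_integral_formula hγ.closed hG hf (fun t ht => (hγ.mem_diff t ht).1)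
    (fun z hz => (mul_eq_zero.1 (hγ.index_eq_zero z hz)).resolve_left hpi) hwG
    (by
      rintro ⟨t, ht, rfl⟩
      exact (hγ.mem_diff t ht).2 hwK)
  have h1 := hγ.index_eq_one w hwK
  unfold curveIndex at h1
  simp only [analyticCalculus, Ring.inverse_eq_inv', smul_eq_mul, Algebra.algebraMap_self,
    RingHom.id_apply, ← div_eq_mul_inv]
  rw [h, mul_left_comm, h1, mul_one]

end Calculus

/-! ### Positivity of the functional on the calculus -/

open WeakDual in
/-- In a commutative algebra, an inequality between `1`, `z` and `f z` on the spectrum of `b` holds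
for the Gelfand transforms of `1`, `b` and `f(b)`, hence for their images under `ψ`. -/
theorem IsPositiveFunctional.nonneg_analyticCalculus_of_comm {B : Type*} [NormedCommRing B]
    [NormedAlgebra ℂ B] [CompleteSpace B] [StarRing B] [StarModule ℂ B]
    (hB : IsHermitianAlgebra B) {ψ : B →ₗ[ℂ] ℂ} (hψ : IsPositiveFunctional ψ)
    {G : Set ℂ} (hG : IsOpen G) {f : ℂ → ℂ} (hf : DifferentiableOn ℂ f G) {b : B} {γ : ℝ → ℂ}
    (hγ : IsCauchyContour G (spectrum ℂ b) γ) (hb : spectrum ℂ b ⊆ G) {p q r : ℂ}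
    (h : ∀ z ∈ spectrum ℂ b, 0 ≤ p + q * z + r * f z) :
    0 ≤ ψ (p • (1 : B) + q • b + r • analyticCalculus γ f b) := by
  refine hψ.nonneg_of_forall_character hB fun φ => ?_
  have hφb : φ b ∈ spectrum ℂ b := CharacterSpace.mem_spectrum_iff_exists.2 ⟨φ, rfl⟩
  have hcalc : φ (analyticCalculus γ f b) = f (φ b) := by
    have := map_analyticCalculus (CharacterSpace.equivAlgHom φ) (map_continuous φ)
      hf.continuousOn hγ
    rw [CharacterSpace.equivAlgHom_coe] at this
    rw [this, analyticCalculus_complex hG hf hγ hφb (hb hφb)]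
  simpa [hcalc] using h _ hφb

section DoubleCommutant

variable {A : Type*} [NormedRing A] [NormedAlgebra ℂ A] [StarRing A] [StarModule ℂ A]

/-- The double commutant of `{c, star c}`. For normal `c` it is a commutative closed
`*`-subalgebra that contains `c` and the inverses of its elements. -/
def doubleCommutant (c : A) : StarSubalgebra ℂ A :=
  StarSubalgebra.centralizer ℂ (StarSubalgebra.centralizer ℂ {c} : Set A)

theorem coe_doubleCommutant (c : A) :
    (doubleCommutant c : Set A) = ({c} ∪ star {c} : Set A).centralizer.centralizer :=
  StarSubalgebra.coe_centralizer_centralizer ℂ {c}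

theorem self_mem_doubleCommutant (c : A) : c ∈ doubleCommutant c := by
  rw [← SetLike.mem_coe, coe_doubleCommutant]
  exact Set.subset_centralizer_centralizer (by simp)

theorem isClosed_doubleCommutant (c : A) : IsClosed (doubleCommutant c : Set A) := by
  rw [coe_doubleCommutant]
  exact Set.isClosed_centralizer _

theorem IsSelfAdjoint.mul_comm_of_mem_doubleCommutant {c : A} (hc : IsSelfAdjoint c) {x y : A}
    (hx : x ∈ doubleCommutant c) (hy : y ∈ doubleCommutant c) : x * y = y * x := by
  rw [← SetLike.mem_coe, coe_doubleCommutant, star_singleton, hc.star_eq, union_self] at hx hy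
  exact Set.centralizer_centralizer_comm_of_comm (by simp) x hx y hy

theorem spectrum_coe_doubleCommutant (c : A) (x : doubleCommutant c) :
    spectrum ℂ (x : A) = spectrum ℂ x := by
  have hunit : ∀ y : doubleCommutant c, IsUnit (y : A) ↔ IsUnit y := by
    intro y
    refine ⟨fun hy => ?_, fun hy => hy.map (doubleCommutant c).subtype⟩
    obtain ⟨u, hu⟩ := hy
    have hmem : ((u⁻¹ : Aˣ) : A) ∈ doubleCommutant c := by
      have hy := y.2
      rw [← SetLike.mem_coe, coe_doubleCommutant, ← hu] at hy
      rw [← SetLike.mem_coe, coe_doubleCommutant]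
      exact fun z hz => (Commute.units_inv_right (hy z hz : Commute z u)).eq
    refine isUnit_iff_exists.2 ⟨⟨_, hmem⟩, ?_, ?_⟩
    · exact Subtype.ext (by simp [← hu])
    · exact Subtype.ext (by simp [← hu])
  ext z
  rw [spectrum.mem_iff, spectrum.mem_iff, not_iff_not, ← hunit]
  rfl

/-- The commutative case applied to the double commutant of a selfadjoint element. -/
theorem IsPositiveFunctional.nonneg_analyticCalculus [CompleteSpace A]
    (hA : IsHermitianAlgebra A) {ψ : A →ₗ[ℂ] ℂ} (hψ : IsPositiveFunctional ψ)
    {G : Set ℂ} (hG : IsOpen G) {f : ℂ → ℂ} (hf : DifferentiableOn ℂ f G) {c : A}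
    (hc : IsSelfAdjoint c) {γ : ℝ → ℂ}
    (hγ : IsCauchyContour G (spectrum ℂ c) γ) (hcG : spectrum ℂ c ⊆ G) {p q r : ℂ}
    (h : ∀ z ∈ spectrum ℂ c, 0 ≤ p + q * z + r * f z) :
    0 ≤ ψ (p • (1 : A) + q • c + r • analyticCalculus γ f c) := by
  let b : doubleCommutant c := ⟨c, self_mem_doubleCommutant c⟩
  let _ : NormedCommRing (doubleCommutant c) :=
    { (inferInstance : NormedRing (doubleCommutant c)) with
      mul_comm := fun x y => Subtype.ext (hc.mul_comm_of_mem_doubleCommutant x.2 y.2) }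
  have : CompleteSpace (doubleCommutant c) :=
    (isClosed_doubleCommutant c).completeSpace_coe
  have hsp : ∀ x : doubleCommutant c, spectrum ℂ (x : A) = spectrum ℂ x :=
    spectrum_coe_doubleCommutant c
  have hB : IsHermitianAlgebra (doubleCommutant c) := fun a ha z hz =>
    hA a (congrArg Subtype.val ha) z (by rwa [hsp])
  let ι : doubleCommutant c →ₐ[ℂ] A := (doubleCommutant c).subtype
  have hψ' : IsPositiveFunctional (ψ.comp ι.toLinearMap) := fun a ha =>
    hψ a ⟨congrArg Subtype.val ha.1, by
      rw [hsp]
      exact ha.2⟩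
  have hbc : spectrum ℂ c = spectrum ℂ b := hsp b
  rw [hbc] at hγ hcG h
  have hkey := hψ'.nonneg_analyticCalculus_of_comm hB hG hf hγ hcG h
  have hmap : ι (analyticCalculus γ f b) = analyticCalculus γ f c :=
    map_analyticCalculus ι continuous_subtype_val hf.continuousOn hγ
  have hιb : ι b = c := rfl
  simpa only [LinearMap.comp_apply, AlgHom.toLinearMap_apply, map_add, map_smul, map_one, hmap,
    hιb] using hkey

end DoubleCommutant

/-! ### Convex functions on an interval -/

section Convex

variable {g : ℝ → ℝ} {m M : ℝ}

theorem ConvexOn.add_mul_sub_le_of_hasDerivAt {S : Set ℝ} (hg : ConvexOn ℝ S g) {g' s t : ℝ}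
    (hs : s ∈ S) (ht : t ∈ S) (hd : HasDerivAt g g' s) : g s + g' * (t - s) ≤ g t := by
  rcases lt_trichotomy s t with h | rfl | h
  · have := hg.le_slope_of_hasDerivAt hs ht h hd
    rw [slope_def_field, le_div_iff₀ (sub_pos.2 h)] at this
    linarith
  · simp
  · have := hg.slope_le_of_hasDerivAt ht hs h hd
    rw [slope_def_field, div_le_iff₀ (sub_pos.2 h)] at this
    linarith

theorem ConvexOn.le_chord (hg : ConvexOn ℝ (Icc m M) g) (hmM : m < M) {s : ℝ}
    (hs : s ∈ Icc m M) : g s ≤ g m + (g M - g m) / (M - m) * (s - m) := by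
  have hd : 0 < M - m := sub_pos.2 hmM
  have h := hg.2 (left_mem_Icc.2 hmM.le) (right_mem_Icc.2 hmM.le)
    (div_nonneg (sub_nonneg.2 hs.2) hd.le) (div_nonneg (sub_nonneg.2 hs.1) hd.le)
    (by rw [← add_div, div_eq_one_iff_eq hd.ne']; ring)
  simp only [smul_eq_mul] at h
  have e1 : (M - s) / (M - m) * m + (s - m) / (M - m) * M = s := by field_simp; ring
  have e2 : (M - s) / (M - m) * g m + (s - m) / (M - m) * g M =
      g m + (g M - g m) / (M - m) * (s - m) := by field_simp; ring
  rwa [e1, e2] at h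

/-- The gap between a convex function and its chord, at a point of the left or the right half of
the interval. The midpoint lies between that point and the opposite end of the interval, which
bounds the value at the point from below. -/
theorem ConvexOn.chord_sub_le (hg : ConvexOn ℝ (Icc m M) g) (hmM : m < M) {s : ℝ}
    (hs : s ∈ Icc m M) :
    g m + (g M - g m) / (M - m) * (s - m) - g s ≤
      (1 + 2 * (|s - (m + M) / 2| / (M - m))) * ((g m + g M) / 2 - g ((m + M) / 2)) := by
  have hd : 0 < M - m := sub_pos.2 hmM
  rcases le_total s ((m + M) / 2) with h | h
  · have hMs : 0 < M - s := by linarith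
    have hc := hg.2 hs (right_mem_Icc.2 hmM.le)
      (show 0 ≤ (M - m) / (2 * (M - s)) by positivity)
      (show 0 ≤ (M + m - 2 * s) / (2 * (M - s)) from div_nonneg (by linarith) (by positivity))
      (by field_simp; ring)
    simp only [smul_eq_mul] at hc
    have e1 : (M - m) / (2 * (M - s)) * s + (M + m - 2 * s) / (2 * (M - s)) * M = (m + M) / 2 := by
      field_simp; ring
    rw [e1] at hc
    have h2 := mul_le_mul_of_nonneg_left hc (show 0 ≤ 2 * (M - s) / (M - m) by positivity)
    have e2 : 2 * (M - s) / (M - m) *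
        ((M - m) / (2 * (M - s)) * g s + (M + m - 2 * s) / (2 * (M - s)) * g M) =
        g s + (M + m - 2 * s) / (M - m) * g M := by field_simp
    rw [e2] at h2
    rw [abs_of_nonpos (by linarith)]
    have e3 : (1 + 2 * (-(s - (m + M) / 2) / (M - m))) * ((g m + g M) / 2 - g ((m + M) / 2)) -
        (g m + (g M - g m) / (M - m) * (s - m) - g s) =
        g s + (M + m - 2 * s) / (M - m) * g M - 2 * (M - s) / (M - m) * g ((m + M) / 2) := by
      field_simp; ring
    linarith
  · have hMs : 0 < s - m := by linarith
    have hc := hg.2 hs (left_mem_Icc.2 hmM.le)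
      (show 0 ≤ (M - m) / (2 * (s - m)) by positivity)
      (show 0 ≤ (2 * s - M - m) / (2 * (s - m)) from div_nonneg (by linarith) (by positivity))
      (by field_simp; ring)
    simp only [smul_eq_mul] at hc
    have e1 : (M - m) / (2 * (s - m)) * s + (2 * s - M - m) / (2 * (s - m)) * m = (m + M) / 2 := by
      field_simp; ring
    rw [e1] at hc
    have h2 := mul_le_mul_of_nonneg_left hc (show 0 ≤ 2 * (s - m) / (M - m) by positivity)
    have e2 : 2 * (s - m) / (M - m) *
        ((M - m) / (2 * (s - m)) * g s + (2 * s - M - m) / (2 * (s - m)) * g m) =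
        g s + (2 * s - M - m) / (M - m) * g m := by field_simp
    rw [e2] at h2
    rw [abs_of_nonneg (by linarith)]
    have e3 : (1 + 2 * ((s - (m + M) / 2) / (M - m))) * ((g m + g M) / 2 - g ((m + M) / 2)) -
        (g m + (g M - g m) / (M - m) * (s - m) - g s) =
        g s + (2 * s - M - m) / (M - m) * g m - 2 * (s - m) / (M - m) * g ((m + M) / 2) := by
      field_simp; ring
    linarith

theorem ConvexOn.midpoint_gap_le (hg : ConvexOn ℝ (Icc m M) g) (hmM : m < M) {s : ℝ}
    (hs : s ∈ Icc m M) :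
    (1 + 2 * (|s - (m + M) / 2| / (M - m))) * ((g m + g M) / 2 - g ((m + M) / 2)) ≤
      g m + g M - 2 * g ((m + M) / 2) := by
  have hd : 0 < M - m := sub_pos.2 hmM
  have hc := hg.2 (left_mem_Icc.2 hmM.le) (right_mem_Icc.2 hmM.le)
    (show (0 : ℝ) ≤ 1 / 2 by norm_num) (show (0 : ℝ) ≤ 1 / 2 by norm_num) (by norm_num)
  simp only [smul_eq_mul] at hc
  rw [show 1 / 2 * m + 1 / 2 * M = (m + M) / 2 by ring] at hc
  have h1 : |s - (m + M) / 2| / (M - m) ≤ 1 / 2 := by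
    rw [div_le_iff₀ hd, abs_le]
    constructor <;> linarith [hs.1, hs.2]
  have h2 := mul_le_mul_of_nonneg_right
    (show 1 + 2 * (|s - (m + M) / 2| / (M - m)) ≤ 2 by linarith)
    (show 0 ≤ (g m + g M) / 2 - g ((m + M) / 2) by linarith)
  linarith

end Convex

/-! ### The reverse Jensen inequality -/

theorem theorem2p2
    {A : Type*} [NormedRing A] [NormedAlgebra ℂ A] [CompleteSpace A] [StarRing A]
    [StarModule ℂ A] (hA : IsHermitianAlgebra A)
    (G : Set ℂ) (hG : IsOpen G) (f : ℂ → ℂ) (hf : AnalyticOnNhd ℂ f G)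
    (I : Set ℝ) (hIG : ∀ x ∈ I, (x : ℂ) ∈ G)
    (hreal : ∀ x ∈ I, (f (x : ℂ)).im = 0)
    (hconv : ConvexOn ℝ I (fun x : ℝ => (f (x : ℂ)).re))
    (ψ : A →ₗ[ℂ] ℂ) (hψ : IsPositiveFunctional ψ) (hψ1 : ψ 1 = 1)
    (m M : ℝ) (hmM : m < M) (hI : Set.Icc m M ⊆ I)
    (c : A) (hc : IsSelfAdjoint c) (hσ : spectrum ℂ c ⊆ Complex.ofReal '' Set.Icc m M)
    (γ : ℝ → ℂ) (hγ : IsCauchyContour G (spectrum ℂ c) γ) :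
    (ψ c).im = 0 ∧ (ψ c).re ∈ Set.Icc m M ∧
    (ψ (analyticCalculus γ f c)).im = 0 ∧
    0 ≤ (ψ (analyticCalculus γ f c)).re - (f ((ψ c).re : ℂ)).re ∧
    (ψ (analyticCalculus γ f c)).re - (f ((ψ c).re : ℂ)).re ≤
      (1 + 2 * (|(ψ c).re - (m + M) / 2| / (M - m))) *
        (((f (m : ℂ)).re + (f (M : ℂ)).re) / 2 - (f (((m + M) / 2 : ℝ) : ℂ)).re) ∧
    (1 + 2 * (|(ψ c).re - (m + M) / 2| / (M - m))) *
        (((f (m : ℂ)).re + (f (M : ℂ)).re) / 2 - (f (((m + M) / 2 : ℝ) : ℂ)).re) ≤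
      (f (m : ℂ)).re + (f (M : ℂ)).re - 2 * (f (((m + M) / 2 : ℝ) : ℂ)).re := by
  have hfd : DifferentiableOn ℂ f G := hf.differentiableOn
  have hcG : spectrum ℂ c ⊆ G := fun z hz => by
    obtain ⟨x, hx, rfl⟩ := hσ hz
    exact hIG x (hI hx)
  have hconv' : ConvexOn ℝ (Icc m M) (fun x : ℝ => (f (x : ℂ)).re) :=
    hconv.subset hI (convex_Icc m M)
  have hfre : ∀ x ∈ Icc m M, f (x : ℂ) = ((f (x : ℂ)).re : ℂ) := fun x hx =>
    Complex.ext rfl (hreal x (hI hx))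
  -- a pointwise inequality between `1`, `x` and `f x` on `[m, M]` passes to `ψ`
  have key : ∀ p q r : ℝ, (∀ x ∈ Icc m M, 0 ≤ p + q * x + r * (f (x : ℂ)).re) →
      0 ≤ (p : ℂ) + q * ψ c + r * ψ (analyticCalculus γ f c) := by
    intro p q r h
    have h0 := hψ.nonneg_analyticCalculus hA hG hfd hc hγ hcG (p := p) (q := q) (r := r)
      (fun z hz => by
        obtain ⟨x, hx, rfl⟩ := hσ hz
        rw [hfre x hx]
        exact_mod_cast h x hx)
    simpa [hψ1] using h0
  have hc1 := Complex.nonneg_iff.1 (key (-m) 1 0 fun x hx => by linarith [hx.1])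
  have hc2 := Complex.nonneg_iff.1 (key M (-1) 0 fun x hx => by linarith [hx.2])
  simp at hc1 hc2
  have him : (ψ c).im = 0 := hc1.2.symm
  have hs : (ψ c).re ∈ Icc m M := ⟨by linarith, by linarith⟩
  have hψc : ψ c = ((ψ c).re : ℂ) := Complex.ext rfl him
  set s : ℝ := (ψ c).re with hsdef
  have hd : HasDerivAt (fun x : ℝ => (f (x : ℂ)).re) (deriv f (s : ℂ)).re s :=
    (hf _ (hIG s (hI hs))).differentiableAt.hasDerivAt.real_of_complex
  set k : ℝ := (deriv f (s : ℂ)).re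
  set K : ℝ := ((f (M : ℂ)).re - (f (m : ℂ)).re) / (M - m)
  -- the tangent of `f` at `s = ψ c`, and the chord of `f` over `[m, M]`
  have hlow := Complex.nonneg_iff.1 (key (-(f (s : ℂ)).re + k * s) (-k) 1 fun x hx => by
    linarith [hconv'.add_mul_sub_le_of_hasDerivAt hs hx hd])
  have hup := Complex.nonneg_iff.1 (key ((f (m : ℂ)).re - K * m) K (-1) fun x hx => by
    have := hconv'.le_chord hmM hx
    linarith)
  rw [hψc] at hlow hup
  simp at hlow hup
  have hgap := hconv'.chord_sub_le hmM hs
  have hlast := hconv'.midpoint_gap_le hmM hs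
  refine ⟨him, hs, hlow.2.symm, by linarith, le_trans ?_ hgap, hlast⟩
  linarith
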